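/- Let $\kappa_n=\mathbb{Z}[X_1^{\pm1},\dots,X_n^{\pm1}]$. Let $K$ be an oriented virtual link diagram, i.e. an immersion of $n$ oriented circles, numbered $1,\dots,n$, in the plane with finitely many transversal double points, each marked as a classical crossing (with over/under information) or as a virtual crossing; assume that the height is a Morse function on $K$ and that crossings and extrema lie at distinct heights. Every piece of the $i$-th circle carries the variable $X_i$. The $\kappa_n$-module $\mathrm{CM}(K)$ has one generator for each connected component of $K$ minus its crossings and extreme points. Its relations are $e+e'=0$ for the two strands $e,e'$ at each maximum or minimum and, at each crossing with bottom left, bottom right, top left and top right strands $e,f,c,d$, where $e,d$ carry the variable $X$ and $f,c$ carry $Y$: * $c=X^{-\epsilon}f$, $d=e+f-X^{-\epsilon}f$ if the strand $e,d$ is the over strand, where $\epsilon=1$ if it is oriented upwards and $\epsilon=-1$ if downwards; * $d=Y^{\epsilon}e$, $c=e+f-Y^{\epsilon}e$ if the strand $f,c$ is the over strand, where $\epsilon=1$ if it is oriented upwards and $\epsilon=-1$ if downwards; * $c=f$, $d=e$ if the crossing is virtual. The Alexander module $\mathrm{Alex}(K)$ has one generator for each connected component of $K$ minus its crossings. At each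 classical crossing the two parts of the over strand are identified, to a generator $o$ with variable $Y$, and $r=-Y^{-1}o+Y^{-1}l+Y^{-1}Xo$, where $l$ and $r$ are the parts of the under strand (with variable $X$) on the left and on the right of the oriented over strand. At a virtual crossing the two parts of each strand are identified. The module $\mathrm{Alex}'(K)$ is defined in the same way, except that at a virtual crossing of a strand with variable $X$ passing from the left to the right of a strand with variable $Y$, the outgoing part of the first is $Y^{-1}$ times its incoming part, and the outgoing part of the second is $X$ times its incoming part. Let $K^*$ be the mirror image of $K$: over and under are exchanged at every classical crossing, and virtual crossings are unchanged. **Theorem.** For every such $K$ there is an isomorphism of $\kappa_n$-modules $\mathrm{CM}(K)\cong\mathrm{Alex}'(K^*)$. If $K$ is classical (has no virtual crossings), then $\mathrm{CM}(K)\cong\mathrm{Alex}(K^*)$ as $\kappa_n$-modules, and $\mathrm{CM}(K)$ is the Alexander module of $K$ up to inversion of the variables: there is an isomorphism of abelian groups $\varphi:\mathrm{CM}(K)\to\mathrm{Alex}(K)$ with $\varphi(r\,x)=\bar r\,\varphi(x)$ for all $r\in\kappa_n$ and $x\in\mathrm{CM}(K)$, where $r\mapsto\bar r$ is the ring automorphism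 with $X_i\mapsto X_i^{-1}$. -/

import Mathlib

noncomputable section

/-- The Laurent polynomial ring `ℤ[X₁, X₁⁻¹, …, Xₙ, Xₙ⁻¹]`, as the group algebra of `ℤⁿ`. -/
abbrev Kappa (n : ℕ) : Type := AddMonoidAlgebra ℤ (Fin n →₀ ℤ)

/-- The monomial `Xᵢ ^ s`, for an integer exponent `s`. -/
def Kappa.X {n : ℕ} (i : Fin n) (s : ℤ) : Kappa n :=
  AddMonoidAlgebra.single (Finsupp.single i s) 1

/-- The ring endomorphism of `Kappa n` sending each `Xᵢ` to `Xᵢ⁻¹`. -/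
def Kappa.bar (n : ℕ) : Kappa n →+* Kappa n :=
  AddMonoidAlgebra.mapDomainRingHom ℤ (negAddMonoidHom : (Fin n →₀ ℤ) →+ (Fin n →₀ ℤ))

/-- What happens to the height function between two consecutive generic levels: a local minimum,
a local maximum, or a transversal double point. -/
inductive Shape : Type
  | minimum
  | maximum
  | doublePoint

/-- The number of strands entering the event from below. -/
def Shape.bot : Shape → ℕ
  | minimum => 0
  | maximum => 2
  | doublePoint => 2

/-- The number of strands leaving the event at the top. -/
def Shape.top : Shape → ℕ
  | minimum => 2
  | maximum => 0
  | doublePoint => 2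

/-- An immersion of finitely many circles into the plane, on which the height is a Morse function
and whose extrema and double points lie at distinct heights, up to planar isotopy preserving the
order of these heights. The events (extrema and double points) are listed from bottom to top.
The `t`-th event lies between the generic levels `t` and `t + 1`; `width t` is the number of points
of the curve on level `t`, and `pos t` is the number of strands passing to the left of
event `t`. -/
structure MorseCurve where
  height : ℕ
  shape : Fin height → Shape
  pos : Fin height → ℕ
  width : Fin (height + 1) → ℕ
  width_first : width 0 = 0
  width_last : width (Fin.last height) = 0
  width_below : ∀ t, ∃ r, width t.castSucc = pos t + (shape t).bot + r ∧
    width t.succ = pos t + (shape t).top + r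

namespace MorseCurve

/-- The points of the curve on the generic levels: `⟨t, j⟩` is the `j`-th point from the left
on level `t`, counted from `0`. -/
abbrev Point (C : MorseCurve) : Type := Σ t : Fin (C.height + 1), Fin (C.width t)

/-- `p` and `q` are joined by a strand which runs past event `t`, on its left or on its right. -/
def Passes (C : MorseCurve) (t : Fin C.height) (p q : C.Point) : Prop :=
  p.1 = t.castSucc ∧ q.1 = t.succ ∧
    (((p.2 : ℕ) < C.pos t ∧ (q.2 : ℕ) = p.2) ∨
      ∃ r : ℕ, (p.2 : ℕ) = C.pos t + (C.shape t).bot + r ∧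
        (q.2 : ℕ) = C.pos t + (C.shape t).top + r)

/-- Event `t` is a minimum, with `p` the left and `q` the right of its two strands. -/
def IsMin (C : MorseCurve) (t : Fin C.height) (p q : C.Point) : Prop :=
  C.shape t = .minimum ∧ p.1 = t.succ ∧ q.1 = t.succ ∧
    (p.2 : ℕ) = C.pos t ∧ (q.2 : ℕ) = C.pos t + 1

/-- Event `t` is a maximum, with `p` the left and `q` the right of its two strands. -/
def IsMax (C : MorseCurve) (t : Fin C.height) (p q : C.Point) : Prop :=
  C.shape t = .maximum ∧ p.1 = t.castSucc ∧ q.1 = t.castSucc ∧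
    (p.2 : ℕ) = C.pos t ∧ (q.2 : ℕ) = C.pos t + 1

/-- The four ends of the strands at event `t` are, if it is a double point, `bl` (bottom left),
`br` (bottom right), `tl` (top left) and `tr` (top right). -/
def Corners (C : MorseCurve) (t : Fin C.height) (bl br tl tr : C.Point) : Prop :=
  bl.1 = t.castSucc ∧ br.1 = t.castSucc ∧ tl.1 = t.succ ∧ tr.1 = t.succ ∧
    (bl.2 : ℕ) = C.pos t ∧ (br.2 : ℕ) = C.pos t + 1 ∧
    (tl.2 : ℕ) = C.pos t ∧ (tr.2 : ℕ) = C.pos t + 1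

/-- `p` and `q` are joined by a piece of the curve that contains no double point and no
extremum. -/
def JoinedPlain (C : MorseCurve) (p q : C.Point) : Prop := ∃ t, C.Passes t p q

/-- `p` and `q` are joined by a piece of the curve that contains no double point. -/
def JoinedSmooth (C : MorseCurve) (p q : C.Point) : Prop :=
  ∃ t, C.Passes t p q ∨ C.IsMin t p q ∨ C.IsMax t p q

/-- `p` and `q` are joined by a piece of the immersed circle they lie on; at a double point the
immersed circles go straight on, `bl` to `tr` and `br` to `tl`. -/
def JoinedCircle (C : MorseCurve) (p q : C.Point) : Prop :=
  C.JoinedSmooth p q ∨ ∃ t, C.shape t = .doublePoint ∧ ∃ bl br tl tr, C.Corners t bl br tl tr ∧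
    ((p = bl ∧ q = tr) ∨ (p = br ∧ q = tl))

/-- The connected components of the curve minus its double points and its extrema. -/
abbrev MorseArc (C : MorseCurve) : Type := Quot C.JoinedPlain

/-- The connected components of the curve minus its double points. -/
abbrev Arc (C : MorseCurve) : Type := Quot C.JoinedSmooth

/-- The immersed circles. -/
abbrev Circle (C : MorseCurve) : Type := Quot C.JoinedCircle

end MorseCurve

/-- The type of a crossing, drawn in the plane: the strand going from bottom left to top right
(the "rising" strand) passes over, or the other one (from bottom right to top left, the "falling"
strand) passes over, or the crossing is virtual. -/
inductive CrossingKind : Type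
  | risingOver
  | fallingOver
  | virtual

/-- Exchange over and under at a classical crossing; leave a virtual crossing unchanged.
(A quarter turn of the picture has the same effect on the type of a crossing.) -/
def CrossingKind.switch : CrossingKind → CrossingKind
  | risingOver => fallingOver
  | fallingOver => risingOver
  | virtual => virtual

/-- An oriented virtual link diagram in Morse position, with `n` immersed circles, which are
numbered by `Fin n`. `up p` tells whether the strand through `p` is oriented upwards. -/
structure VirtualLinkDiagram (n : ℕ) extends MorseCurve where
  up : toMorseCurve.Point → Bool
  up_passes : ∀ t p q, toMorseCurve.Passes t p q → up p = up q
  up_min : ∀ t p q, toMorseCurve.IsMin t p q → up p ≠ up q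
  up_max : ∀ t p q, toMorseCurve.IsMax t p q → up p ≠ up q
  up_doublePoint : ∀ t bl br tl tr, shape t = .doublePoint →
    toMorseCurve.Corners t bl br tl tr → up bl = up tr ∧ up br = up tl
  circle : toMorseCurve.Circle ≃ Fin n
  kind : {t : Fin height // shape t = .doublePoint} → CrossingKind

namespace VirtualLinkDiagram

variable {n : ℕ}

/-- The mirror image: over and under are exchanged at each classical crossing, and the virtual
crossings are unchanged. -/
def mirror (K : VirtualLinkDiagram n) : VirtualLinkDiagram n :=
  { K with kind := fun t => (K.kind t).switch }

/-- A diagram is classical if it has no virtual crossing. -/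
def IsClassical (K : VirtualLinkDiagram n) : Prop := ∀ t, K.kind t ≠ .virtual

/-- `X^s`, where `X` is the variable of the circle through `p`. -/
def X (K : VirtualLinkDiagram n) (p : K.Point) (s : ℤ) : Kappa n :=
  Kappa.X (K.circle (Quot.mk _ p)) s

/-- `1` if the strand through `p` goes up, `-1` if it goes down. -/
def sgn (K : VirtualLinkDiagram n) (p : K.Point) : ℤ := if K.up p then 1 else -1

/-! ### The module `CM(K)` -/

/-- The generator of `CM(K)` given by the strand through `p`. -/
def cmGen (K : VirtualLinkDiagram n) (p : K.Point) : K.MorseArc →₀ Kappa n :=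
  Finsupp.single (Quot.mk _ p) 1

/-- The two relators of `CM(K)` at a crossing. -/
def cmCrossing (K : VirtualLinkDiagram n) (k : CrossingKind) (bl br tl tr : K.Point) :
    Set (K.MorseArc →₀ Kappa n) :=
  let e := K.cmGen bl
  let f := K.cmGen br
  match k with
  | .risingOver =>
      let u := K.X bl (-K.sgn bl)
      {K.cmGen tl - u • f, K.cmGen tr - (e + f - u • f)}
  | .fallingOver =>
      let u := K.X br (K.sgn br)
      {K.cmGen tr - u • e, K.cmGen tl - (e + f - u • e)}
  | .virtual => {K.cmGen tl - f, K.cmGen tr - e}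

/-- The relators of `CM(K)`. -/
def cmRelators (K : VirtualLinkDiagram n) : Set (K.MorseArc →₀ Kappa n) :=
  {x | (∃ t p q, (K.IsMin t p q ∨ K.IsMax t p q) ∧ x = K.cmGen p + K.cmGen q) ∨
    ∃ t bl br tl tr, K.Corners t.1 bl br tl tr ∧ x ∈ K.cmCrossing (K.kind t) bl br tl tr}

/-- The module `CM(K)`. -/
abbrev CM (K : VirtualLinkDiagram n) : Type :=
  (K.MorseArc →₀ Kappa n) ⧸ Submodule.span (Kappa n) K.cmRelators

/-! ### The modules `Alex(K)` and `Alex'(K)` -/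

/-- A crossing, turned so that both strands are oriented upwards. Then the strand from `xin`
(bottom left) to `xout` (top right) crosses the other one from its left to its right, and the
strand from `yin` (bottom right) to `yout` (top left) crosses the first one from its right to its
left. -/
structure TurnedCrossing (P : Type) where
  kind : CrossingKind
  xin : P
  yin : P
  yout : P
  xout : P

/-- Turn a crossing by a multiple of a quarter turn so that both strands go up. -/
def turn (K : VirtualLinkDiagram n) (k : CrossingKind) (bl br tl tr : K.Point) :
    TurnedCrossing K.Point :=
  match K.up bl, K.up br with
  | true, true => ⟨k, bl, br, tl, tr⟩
  | true, false => ⟨k.switch, tl, bl, tr, br⟩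
  | false, false => ⟨k, tr, tl, br, bl⟩
  | false, true => ⟨k.switch, br, tr, bl, tl⟩

/-- The generator of `Alex(K)` and of `Alex'(K)` given by the arc through `p`. -/
def alexGen (K : VirtualLinkDiagram n) (p : K.Point) : K.Arc →₀ Kappa n :=
  Finsupp.single (Quot.mk _ p) 1

/-- The Fox derivative of the Wirtinger relation `r = o⁻¹ l o`, where `o` is the over strand, and
`l` and `r` are the parts of the under strand on the left and on the right of `o`:
`r = -Y⁻¹ o + Y⁻¹ l + Y⁻¹ X o` in the module, where `Y` belongs to `o` and `X` to the under
strand. -/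
def foxRelator (K : VirtualLinkDiagram n) (o l r : K.Point) : K.Arc →₀ Kappa n :=
  K.alexGen r - (-(K.X o (-1) • K.alexGen o) + K.X o (-1) • K.alexGen l +
    (K.X o (-1) * K.X l 1) • K.alexGen o)

/-- The two relators of `Alex(K)` at a crossing. -/
def alexCrossing (K : VirtualLinkDiagram n) (c : TurnedCrossing K.Point) :
    Set (K.Arc →₀ Kappa n) :=
  match c.kind with
  | .fallingOver => {K.alexGen c.yout - K.alexGen c.yin, K.foxRelator c.yin c.xin c.xout}
  | .risingOver => {K.alexGen c.xout - K.alexGen c.xin, K.foxRelator c.xin c.yout c.yin}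
  | .virtual => {K.alexGen c.yout - K.alexGen c.yin, K.alexGen c.xout - K.alexGen c.xin}

/-- The two relators of `Alex'(K)` at a crossing; only those at virtual crossings differ from the
ones of `Alex(K)`. -/
def alexCrossing' (K : VirtualLinkDiagram n) (c : TurnedCrossing K.Point) :
    Set (K.Arc →₀ Kappa n) :=
  match c.kind with
  | .fallingOver => {K.alexGen c.yout - K.alexGen c.yin, K.foxRelator c.yin c.xin c.xout}
  | .risingOver => {K.alexGen c.xout - K.alexGen c.xin, K.foxRelator c.xin c.yout c.yin}
  | .virtual => {K.alexGen c.yout - K.X c.xin 1 • K.alexGen c.yin,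
      K.alexGen c.xout - K.X c.yin (-1) • K.alexGen c.xin}

/-- The relators of `Alex(K)`. -/
def alexRelators (K : VirtualLinkDiagram n) : Set (K.Arc →₀ Kappa n) :=
  {x | ∃ t bl br tl tr, K.Corners t.1 bl br tl tr ∧
    x ∈ K.alexCrossing (K.turn (K.kind t) bl br tl tr)}

/-- The relators of `Alex'(K)`. -/
def alexRelators' (K : VirtualLinkDiagram n) : Set (K.Arc →₀ Kappa n) :=
  {x | ∃ t bl br tl tr, K.Corners t.1 bl br tl tr ∧
    x ∈ K.alexCrossing' (K.turn (K.kind t) bl br tl tr)}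

/-- The Alexander module `Alex(K)`. -/
abbrev Alex (K : VirtualLinkDiagram n) : Type :=
  (K.Arc →₀ Kappa n) ⧸ Submodule.span (Kappa n) K.alexRelators

/-- The variant `Alex'(K)` of the Alexander module. -/
abbrev Alex' (K : VirtualLinkDiagram n) : Type :=
  (K.Arc →₀ Kappa n) ⧸ Submodule.span (Kappa n) K.alexRelators'

end VirtualLinkDiagram

end

/-! Both comparisons rest on region functions. A flow on the curve (values constant along strands,
summing to zero at an extremum, with equal sums below and above a double point) has partial sums
from the left that depend only on the region of the plane. The oriented variables form a flow in
`ℤⁿ` (`isFlow_charge`); its region function `A` is a multivariable Alexander numbering.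

`CM(K) ≅ Alex'(K*)`: a generator of `CM(K)` is sent to the corresponding Alexander generator times ±
the monomial of `A` on the left of the oriented strand, the sign being that of its vertical
direction. The sign turns `e + e' = 0` at extrema into equality along an arc. Crossing a strand
changes `A` by the variable of that strand: this absorbs the monomial in the first relation at a
classical crossing, which becomes the identification of the two parts of the over strand of `K*`,
and it creates the monomials of `Alex'` at a virtual crossing. The local check is
`forall_crossing_iff`. For classical `K`, `Alex'` and `Alex` coincide.

`CM(K) ≅ CM(K*)` up to inversion, for `K` classical: the generators of `CM` themselves form a flow.
Write `G` for its region function on the target side; a generator of `CM(K)` goes to the increment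
across its strand of the region function `T(-A) G` (`twist`). Division by `T(A)` exchanges the two
kinds of classical crossing (`forall_crossing_twist`), and it undoes itself because a bar-semilinear
map turns `T(-A)` into `T(A)` (`map_twist`). Composing with the first comparison for `K*` gives
`Alex(K)`. -/

noncomputable section

open Finset

/-! ### Monomials -/

namespace Kappa

variable {n : ℕ}

/-- The monomial with a given vector of exponents. -/
def T (a : Fin n →₀ ℤ) : Kappa n := AddMonoidAlgebra.single a 1

theorem T_zero : T (0 : Fin n →₀ ℤ) = 1 := rfl

theorem T_add (a b : Fin n →₀ ℤ) : T (a + b) = T a * T b := by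
  simp [T, AddMonoidAlgebra.single_mul_single]

theorem T_mul_T_neg (a : Fin n →₀ ℤ) : T a * T (-a) = 1 := by
  rw [← T_add, add_neg_cancel, T_zero]

theorem bar_T (a : Fin n →₀ ℤ) : bar n (T a) = T (-a) := by
  simp [T, bar, AddMonoidAlgebra.mapDomainRingHom_apply, AddMonoidAlgebra.mapDomain_single]

theorem bar_comp_bar : (bar n).comp (bar n) = RingHom.id (Kappa n) := by
  refine RingHom.ext fun x => ?_
  induction x using AddMonoidAlgebra.induction_linear with
  | zero => simp
  | add f g hf hg => rw [map_add, hf, hg, map_add]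
  | single a r =>
    simp [bar, AddMonoidAlgebra.mapDomainRingHom_apply, AddMonoidAlgebra.mapDomain_single]

instance : RingHomInvPair (bar n) (bar n) := ⟨bar_comp_bar, bar_comp_bar⟩

end Kappa

/-! ### Semilinear maps between modules given by generators and relators -/

section Presentation

variable {R : Type} [CommRing R]

/-- The semilinear map on a free module with given values on the basis. -/
def Finsupp.semilift (σ : R →+* R) {α M : Type} [AddCommGroup M] [Module R M] (g : α → M) :
    (α →₀ R) →ₛₗ[σ] M :=
  (Finsupp.linearCombination R g).comp (Finsupp.mapRange.linearMap σ.toSemilinearMap)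

theorem Finsupp.semilift_single (σ : R →+* R) {α M : Type} [AddCommGroup M] [Module R M]
    (g : α → M) (a : α) : Finsupp.semilift σ g (Finsupp.single a 1) = g a := by
  simp [Finsupp.semilift]

/-- Mutually inverse assignments of generators which respect the relators give a semilinear
isomorphism. -/
theorem exists_presentation_equiv {P : Type} {r₁ r₂ : P → P → Prop}
    {A₁ : Set (Quot r₁ →₀ R)} {A₂ : Set (Quot r₂ →₀ R)}
    (σ σ' : R →+* R) [RingHomInvPair σ σ'] [RingHomInvPair σ' σ]
    (L₁ : (Quot r₁ →₀ R) →ₛₗ[σ] (Quot r₂ →₀ R) ⧸ Submodule.span R A₂)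
    (L₂ : (Quot r₂ →₀ R) →ₛₗ[σ'] (Quot r₁ →₀ R) ⧸ Submodule.span R A₁)
    (h₁ : ∀ x ∈ A₁, L₁ x = 0) (h₂ : ∀ x ∈ A₂, L₂ x = 0)
    (h₁₂ : ∀ K : ((Quot r₂ →₀ R) ⧸ Submodule.span R A₂) →ₛₗ[σ']
        (Quot r₁ →₀ R) ⧸ Submodule.span R A₁, (∀ x, K (Submodule.Quotient.mk x) = L₂ x) →
      ∀ p, K (L₁ (Finsupp.single (Quot.mk _ p) 1)) =
        Submodule.Quotient.mk (Finsupp.single (Quot.mk _ p) 1))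
    (h₂₁ : ∀ K : ((Quot r₁ →₀ R) ⧸ Submodule.span R A₁) →ₛₗ[σ]
        (Quot r₂ →₀ R) ⧸ Submodule.span R A₂, (∀ x, K (Submodule.Quotient.mk x) = L₁ x) →
      ∀ p, K (L₂ (Finsupp.single (Quot.mk _ p) 1)) =
        Submodule.Quotient.mk (Finsupp.single (Quot.mk _ p) 1)) :
    Nonempty (((Quot r₁ →₀ R) ⧸ Submodule.span R A₁) ≃ₛₗ[σ]
      ((Quot r₂ →₀ R) ⧸ Submodule.span R A₂)) := by
  -- The induced maps exist only from here on, which is why the inverse laws are assumed for every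
  -- map `K` factoring `L₁` or `L₂`.
  let F₁ := Submodule.liftQ (Submodule.span R A₁) L₁ (Submodule.span_le.2 h₁)
  let F₂ := Submodule.liftQ (Submodule.span R A₂) L₂ (Submodule.span_le.2 h₂)
  refine ⟨LinearEquiv.ofLinearMap F₁ F₂ ?_ ?_⟩
  · refine Submodule.linearMap_qext _ (Finsupp.lhom_ext' fun a => LinearMap.ext_ring ?_)
    induction a using Quot.ind with
    | mk p => exact h₂₁ F₁ (fun _ => rfl) p
  · refine Submodule.linearMap_qext _ (Finsupp.lhom_ext' fun a => LinearMap.ext_ring ?_)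
    induction a using Quot.ind with
    | mk p => exact h₁₂ F₂ (fun _ => rfl) p

/-- A module over a commutative ring embeds into a commutative algebra. -/
theorem exists_commRing_embedding (R M : Type) [CommRing R] [AddCommGroup M] [Module R M] :
    ∃ (S : Type) (_ : CommRing S) (i : R →+* S) (j : M →+ S), Function.Injective j ∧
      ∀ r m, j (r • m) = i r * j m := by
  -- The ring is the square-zero extension `R ⊕ M`; it is commutative once the right action on `M`
  -- is the left one.
  let _ : Module Rᵐᵒᵖ M := Module.compHom M ((RingHom.id R).fromOpposite mul_comm)
  have _ : IsCentralScalar R M := ⟨fun _ _ => rfl⟩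
  exact ⟨TrivSqZeroExt R M, inferInstance, TrivSqZeroExt.inlHom R M,
    (TrivSqZeroExt.inrHom R M).toAddMonoidHom, TrivSqZeroExt.inr_injective,
    fun r m => (TrivSqZeroExt.inl_mul_inr r m).symm⟩

end Presentation

/-! ### Flows on a Morse curve -/

namespace MorseCurve

variable (C : MorseCurve) {A : Type} [AddCommGroup A]

/-- A function on the generic points which is constant along strands and such that at each event
the sum over the strands below is equal to the sum over the strands above. -/
structure IsFlow (f : C.Point → A) : Prop where
  passes : ∀ t p q, C.Passes t p q → f p = f q
  extremum : ∀ t p q, C.IsMin t p q ∨ C.IsMax t p q → f p + f q = 0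
  crossing : ∀ t bl br tl tr, C.shape t = .doublePoint → C.Corners t bl br tl tr →
    f bl + f br = f tl + f tr

/-- The value of `f` at the `j`-th point of level `t`, and `0` if there is no such point. -/
def value (f : C.Point → A) (t : Fin (C.height + 1)) (j : ℕ) : A :=
  if h : j < C.width t then f ⟨t, j, h⟩ else 0

/-- The sum of `f` over the first `j` points of level `t`. -/
def partialSum (f : C.Point → A) (t : Fin (C.height + 1)) (j : ℕ) : A :=
  ∑ i ∈ range j, C.value f t i

/-- The sum of `f` over the points to the left of `p`. -/
def left (f : C.Point → A) (p : C.Point) : A := C.partialSum f p.1 p.2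

/-- The sum of `f` over `p` and the points to the left of `p`. -/
def right (f : C.Point → A) (p : C.Point) : A := C.partialSum f p.1 (p.2 + 1)

variable {C}

theorem value_eq (f : C.Point → A) {t : Fin (C.height + 1)} {j : ℕ} (p : C.Point)
    (h₁ : p.1 = t) (h₂ : (p.2 : ℕ) = j) : C.value f t j = f p := by
  obtain ⟨s, i, hi⟩ := p
  subst h₁ h₂
  exact dif_pos hi

theorem partialSum_succ (f : C.Point → A) (t : Fin (C.height + 1)) (j : ℕ) :
    C.partialSum f t (j + 1) = C.partialSum f t j + C.value f t j := sum_range_succ _ _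

theorem right_eq (f : C.Point → A) (p : C.Point) : C.right f p = C.left f p + f p := by
  rw [right, partialSum_succ, value_eq f p rfl rfl, left]

theorem left_congr (f : C.Point → A) {p : C.Point} {t : Fin (C.height + 1)} {j : ℕ}
    (h₁ : p.1 = t) (h₂ : (p.2 : ℕ) = j) : C.left f p = C.partialSum f t j := by
  subst h₁ h₂; rfl

theorem right_congr (f : C.Point → A) {p : C.Point} {t : Fin (C.height + 1)} {j : ℕ}
    (h₁ : p.1 = t) (h₂ : (p.2 : ℕ) = j) : C.right f p = C.partialSum f t (j + 1) := by
  subst h₁ h₂; rfl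

/-! ### Partial sums of a flow depend only on the region -/

namespace IsFlow

variable {f : C.Point → A}

theorem partialSum_of_le (hf : C.IsFlow f) (t : Fin C.height) {j : ℕ} (hj : j ≤ C.pos t) :
    C.partialSum f t.castSucc j = C.partialSum f t.succ j := by
  refine sum_congr rfl fun i hi => ?_
  obtain ⟨r, h₁, h₂⟩ := C.width_below t
  have hi := mem_range.1 hi
  have hp : i < C.width t.castSucc := by omega
  have hq : i < C.width t.succ := by omega
  rw [value_eq f ⟨t.castSucc, i, hp⟩ rfl rfl, value_eq f ⟨t.succ, i, hq⟩ rfl rfl]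
  exact hf.passes t _ _ ⟨rfl, rfl, Or.inl ⟨by simp; omega, rfl⟩⟩

/-- The region just right of an event gets the same value from both levels: this is exactly the flow
condition at an extremum or a double point. -/
theorem partialSum_past_event (hf : C.IsFlow f) (t : Fin C.height) :
    C.partialSum f t.castSucc (C.pos t + (C.shape t).bot) =
      C.partialSum f t.succ (C.pos t + (C.shape t).top) := by
  have h := hf.partialSum_of_le t le_rfl
  obtain ⟨r, h₁, h₂⟩ := C.width_below t
  cases hs : C.shape t <;> rw [hs] at h₁ h₂ <;> simp only [Shape.bot, Shape.top] at h₁ h₂ ⊢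
  · let p : C.Point := ⟨t.succ, C.pos t, by omega⟩
    let q : C.Point := ⟨t.succ, C.pos t + 1, by omega⟩
    have := hf.extremum t p q (Or.inl ⟨hs, rfl, rfl, rfl, rfl⟩)
    change _ = C.partialSum f t.succ (C.pos t + 1 + 1)
    rw [partialSum_succ, partialSum_succ, value_eq f p rfl rfl, value_eq f q rfl rfl, add_assoc,
      this, add_zero, add_zero, h]
  · let p : C.Point := ⟨t.castSucc, C.pos t, by omega⟩
    let q : C.Point := ⟨t.castSucc, C.pos t + 1, by omega⟩
    have := hf.extremum t p q (Or.inr ⟨hs, rfl, rfl, rfl, rfl⟩)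
    change C.partialSum f t.castSucc (C.pos t + 1 + 1) = _
    rw [partialSum_succ, partialSum_succ, value_eq f p rfl rfl, value_eq f q rfl rfl, add_assoc,
      this, add_zero, add_zero, h]
  · let bl : C.Point := ⟨t.castSucc, C.pos t, by omega⟩
    let br : C.Point := ⟨t.castSucc, C.pos t + 1, by omega⟩
    let tl : C.Point := ⟨t.succ, C.pos t, by omega⟩
    let tr : C.Point := ⟨t.succ, C.pos t + 1, by omega⟩
    have := hf.crossing t bl br tl tr hs ⟨rfl, rfl, rfl, rfl, rfl, rfl, rfl, rfl⟩
    change C.partialSum f t.castSucc (C.pos t + 1 + 1) = C.partialSum f t.succ (C.pos t + 1 + 1)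
    rw [partialSum_succ, partialSum_succ, partialSum_succ, partialSum_succ,
      value_eq f bl rfl rfl, value_eq f br rfl rfl, value_eq f tl rfl rfl, value_eq f tr rfl rfl,
      add_assoc, add_assoc, this, h]

theorem partialSum_of_ge (hf : C.IsFlow f) (t : Fin C.height) {r : ℕ}
    (hr : C.pos t + (C.shape t).bot + r ≤ C.width t.castSucc) :
    C.partialSum f t.castSucc (C.pos t + (C.shape t).bot + r) =
      C.partialSum f t.succ (C.pos t + (C.shape t).top + r) := by
  induction r with
  | zero => exact hf.partialSum_past_event t
  | succ r ih =>
    obtain ⟨s, h₁, h₂⟩ := C.width_below t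
    let p : C.Point := ⟨t.castSucc, C.pos t + (C.shape t).bot + r, by omega⟩
    let q : C.Point := ⟨t.succ, C.pos t + (C.shape t).top + r, by omega⟩
    rw [← add_assoc, ← add_assoc, partialSum_succ, partialSum_succ, ih (by omega),
      value_eq f p rfl rfl, value_eq f q rfl rfl,
      hf.passes t p q ⟨rfl, rfl, Or.inr ⟨r, rfl, rfl⟩⟩]

theorem left_passes (hf : C.IsFlow f) {t : Fin C.height} {p q : C.Point} (h : C.Passes t p q) :
    C.left f p = C.left f q := by
  obtain ⟨h₁, h₂, ⟨h₃, h₄⟩ | ⟨r, h₃, h₄⟩⟩ := h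
  · rw [left_congr f h₁ rfl, left_congr f h₂ h₄, hf.partialSum_of_le t h₃.le]
  · rw [left_congr f h₁ h₃, left_congr f h₂ h₄, hf.partialSum_of_ge t]
    have := p.2.2
    rw [h₃, h₁] at this
    exact this.le

theorem right_passes (hf : C.IsFlow f) {t : Fin C.height} {p q : C.Point} (h : C.Passes t p q) :
    C.right f p = C.right f q := by
  rw [right_eq, right_eq, hf.left_passes h, hf.passes t p q h]

theorem left_corners (hf : C.IsFlow f) {t : Fin C.height} {bl br tl tr : C.Point}
    (h : C.Corners t bl br tl tr) :
    C.left f tl = C.left f bl := by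
  obtain ⟨h₁, -, h₃, -, h₅, -, h₇, -⟩ := h
  rw [left_congr f h₁ h₅, left_congr f h₃ h₇, hf.partialSum_of_le t le_rfl]

end IsFlow

/-! ### Regions around an event, and increments of region functions -/

theorem left_of_corners (f : C.Point → A) {t : Fin C.height} {bl br tl tr : C.Point}
    (h : C.Corners t bl br tl tr) :
    C.left f br = C.right f bl ∧ C.left f tr = C.right f tl := by
  obtain ⟨h₁, h₂, h₃, h₄, h₅, h₆, h₇, h₈⟩ := h
  rw [left_congr f h₂ h₆, right_congr f h₁ h₅, left_congr f h₄ h₈, right_congr f h₃ h₇]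
  exact ⟨rfl, rfl⟩

theorem left_of_extremum (f : C.Point → A) {t : Fin C.height} {p q : C.Point}
    (h : C.IsMin t p q ∨ C.IsMax t p q) : C.left f q = C.right f p := by
  obtain ⟨-, h₁, h₂, h₃, h₄⟩ | ⟨-, h₁, h₂, h₃, h₄⟩ := h <;>
    rw [left_congr f h₂ h₄, right_congr f h₁ h₃]

theorem IsFlow.right_of_extremum {f : C.Point → A} (hf : C.IsFlow f) {t : Fin C.height}
    {p q : C.Point} (h : C.IsMin t p q ∨ C.IsMax t p q) : C.right f q = C.left f p := by
  rw [right_eq, left_of_extremum f h, right_eq, add_assoc, hf.extremum t p q h, add_zero]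

/-- Summing the increments of a function of the level and the position. -/
theorem partialSum_sub (F : Fin (C.height + 1) → ℕ → A) (t : Fin (C.height + 1)) {j : ℕ}
    (hj : j ≤ C.width t) :
    C.partialSum (fun p => F p.1 (p.2 + 1) - F p.1 p.2) t j = F t j - F t 0 := by
  rw [partialSum, ← sum_range_sub]
  refine sum_congr rfl fun i hi => ?_
  exact value_eq _ ⟨t, i, (mem_range.1 hi).trans_le hj⟩ rfl rfl

theorem map_partialSum {B : Type} [AddCommGroup B] (φ : A →+ B) (f : C.Point → A)
    (t : Fin (C.height + 1)) (j : ℕ) :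
    φ (C.partialSum f t j) = C.partialSum (fun p => φ (f p)) t j := by
  rw [partialSum, map_sum]
  refine sum_congr rfl fun i _ => ?_
  unfold value
  split_ifs <;> simp

end MorseCurve

theorem CrossingKind.switch_switch (k : CrossingKind) : k.switch.switch = k := by
  cases k <;> rfl

namespace VirtualLinkDiagram

open MorseCurve

variable {n : ℕ} (K : VirtualLinkDiagram n)

/-! ### The flow of the variables -/

/-- The exponent vector of `X^s`, where `X` is the variable of the circle through `p` and `s` is
`1` or `-1` as the strand through `p` goes up or down. -/
def charge (p : K.Point) : Fin n →₀ ℤ := Finsupp.single (K.circle (Quot.mk _ p)) (K.sgn p)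

variable {K}

theorem circle_eq_of_joinedSmooth {p q : K.Point} (h : K.JoinedSmooth p q) :
    K.circle (Quot.mk _ p) = K.circle (Quot.mk _ q) :=
  congrArg _ (Quot.sound (Or.inl h))

theorem joinedSmooth_of_extremum {t : Fin K.height} {p q : K.Point}
    (h : K.IsMin t p q ∨ K.IsMax t p q) : K.JoinedSmooth p q := ⟨t, Or.inr h⟩

theorem circle_corners {t : Fin K.height} {bl br tl tr : K.Point}
    (ht : K.shape t = .doublePoint) (h : K.Corners t bl br tl tr) :
    K.circle (Quot.mk _ tr) = K.circle (Quot.mk _ bl) ∧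
      K.circle (Quot.mk _ tl) = K.circle (Quot.mk _ br) :=
  ⟨congrArg K.circle (Quot.sound (r := K.JoinedCircle)
      (Or.inr ⟨t, ht, bl, br, tl, tr, h, Or.inl ⟨rfl, rfl⟩⟩)).symm,
    congrArg K.circle (Quot.sound (r := K.JoinedCircle)
      (Or.inr ⟨t, ht, bl, br, tl, tr, h, Or.inr ⟨rfl, rfl⟩⟩)).symm⟩

theorem up_extremum {t : Fin K.height} {p q : K.Point} (h : K.IsMin t p q ∨ K.IsMax t p q) :
    K.up q = !K.up p :=
  Bool.eq_not.2 (h.elim (K.up_min t p q) (K.up_max t p q)).symm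

theorem sgn_extremum {t : Fin K.height} {p q : K.Point} (h : K.IsMin t p q ∨ K.IsMax t p q) :
    K.sgn q = -K.sgn p := by
  rw [sgn, sgn, up_extremum h]
  cases K.up p <;> simp

theorem charge_corners {t : Fin K.height} {bl br tl tr : K.Point}
    (ht : K.shape t = .doublePoint) (h : K.Corners t bl br tl tr) :
    K.charge tr = K.charge bl ∧ K.charge tl = K.charge br := by
  obtain ⟨h₁, h₂⟩ := circle_corners ht h
  obtain ⟨h₃, h₄⟩ := K.up_doublePoint t bl br tl tr ht h
  exact ⟨by rw [charge, charge, sgn, sgn, h₁, h₃], by rw [charge, charge, sgn, sgn, h₂, h₄]⟩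

theorem isFlow_charge : K.IsFlow K.charge where
  passes t p q h := by
    rw [charge, charge, circle_eq_of_joinedSmooth ⟨t, Or.inl h⟩, sgn, sgn, K.up_passes t p q h]
  extremum t p q h := by
    rw [charge, charge, circle_eq_of_joinedSmooth (joinedSmooth_of_extremum h), sgn_extremum h,
      Finsupp.single_neg, add_neg_cancel]
  crossing t bl br tl tr ht h := by
    rw [(charge_corners ht h).1, (charge_corners ht h).2, add_comm]

/-! ### Comparison of `CM(K)` and `Alex'(K*)` -/

variable (K) in
/-- The exponents of the Alexander numbering of the region on the left of the oriented strand
through `p`. -/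
def index (p : K.Point) : Fin n →₀ ℤ := if K.up p then K.left K.charge p else K.right K.charge p

theorem index_passes {t : Fin K.height} {p q : K.Point} (h : K.Passes t p q) :
    K.index p = K.index q := by
  rw [index, index, isFlow_charge.left_passes h, isFlow_charge.right_passes h, K.up_passes t p q h]

/-- At an extremum both the orientation and the two sides are swapped, so the region on the oriented
left stays the same. -/
theorem index_extremum {t : Fin K.height} {p q : K.Point} (h : K.IsMin t p q ∨ K.IsMax t p q) :
    K.index q = K.index p := by
  rw [index, index, left_of_extremum _ h, isFlow_charge.right_of_extremum h, up_extremum h]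
  cases K.up p <;> simp

variable (K) in
/-- The ratio of the generators of `CM(K)` and `Alex'(K*)` given by `p`. -/
def ratio (p : K.Point) : Kappa n := (K.sgn p : Kappa n) * Kappa.T (K.index p)

variable (K) in
/-- The inverse of `ratio`. -/
def ratioInv (p : K.Point) : Kappa n := (K.sgn p : Kappa n) * Kappa.T (-K.index p)

theorem sgn_mul_sgn (p : K.Point) : (K.sgn p : Kappa n) * (K.sgn p : Kappa n) = 1 := by
  rw [sgn]
  split_ifs <;> simp

theorem ratio_mul_ratioInv (p : K.Point) : K.ratio p * K.ratioInv p = 1 := by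
  rw [ratio, ratioInv, mul_mul_mul_comm, sgn_mul_sgn, Kappa.T_mul_T_neg, one_mul]

theorem sgn_passes {t : Fin K.height} {p q : K.Point} (h : K.Passes t p q) :
    K.sgn p = K.sgn q := by rw [sgn, sgn, K.up_passes t p q h]

/-- All four ratios in terms of the monomial `w` of the leftmost region and the two variables.
Inverses are separate letters with `w * w' = 1` etc., so that the crossing check is polynomial
algebra. -/
theorem ratio_corners {t : Fin K.height} {bl br tl tr : K.Point}
    (ht : K.shape t = .doublePoint) (h : K.Corners t bl br tl tr) :
    ∃ w w' x x' y y' : Kappa n, w * w' = 1 ∧ x * x' = 1 ∧ y * y' = 1 ∧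
      (∀ p, p = bl ∨ p = tr → K.X p 1 = x ∧ K.X p (-1) = x') ∧
      (∀ p, p = br ∨ p = tl → K.X p 1 = y ∧ K.X p (-1) = y') ∧
      K.ratio bl = (if K.up bl then w else -(w * x')) ∧
      K.ratio br = (if K.up br then 1 else -y') * (w * if K.up bl then x else x') ∧
      K.ratio tl = (if K.up br then w else -(w * y')) ∧
      K.ratio tr = (if K.up bl then 1 else -x') * (w * if K.up br then y else y') := by
  obtain ⟨c₁, c₂⟩ := circle_corners ht h
  obtain ⟨u₁, u₂⟩ := K.up_doublePoint t bl br tl tr ht h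
  obtain ⟨l₁, l₂⟩ := left_of_corners K.charge h
  have l₃ := isFlow_charge.left_corners h
  have key : ∀ i : Fin n, Kappa.T (Finsupp.single i 1) * Kappa.T (Finsupp.single i (-1)) = 1 := by
    intro i
    rw [Finsupp.single_neg, Kappa.T_mul_T_neg]
  refine ⟨Kappa.T (K.left K.charge bl), Kappa.T (-K.left K.charge bl), K.X bl 1, K.X bl (-1),
    K.X br 1, K.X br (-1), Kappa.T_mul_T_neg _, key _, key _, ?_, ?_, ?_⟩
  · rintro p (rfl | rfl)
    · exact ⟨rfl, rfl⟩
    · simp [VirtualLinkDiagram.X, c₁]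
  · rintro p (rfl | rfl)
    · exact ⟨rfl, rfl⟩
    · simp [VirtualLinkDiagram.X, c₂]
  · have hX : ∀ p s, K.X p s = Kappa.T (Finsupp.single (K.circle (Quot.mk _ p)) s) :=
      fun _ _ => rfl
    simp only [ratio, index, right_eq, l₁, l₂, l₃, sgn, charge, ← u₁, ← u₂, c₁, c₂, hX]
    cases K.up bl <;> cases K.up br <;> simp [Kappa.T_add] <;> (try constructor) <;> ring

theorem mirror_mirror : K.mirror.mirror = K := by
  simp [mirror, CrossingKind.switch_switch]

/-- The equivalence gives well-definedness of the comparison map in both directions, by taking `L'`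
or `L` to be the quotient map. -/
theorem forall_crossing_iff {M : Type} [AddCommGroup M] [Module (Kappa n) M]
    (L : (K.MorseArc →₀ Kappa n) →ₗ[Kappa n] M) (L' : (K.Arc →₀ Kappa n) →ₗ[Kappa n] M)
    {t : Fin K.height} {bl br tl tr : K.Point} (ht : K.shape t = .doublePoint)
    (hC : K.Corners t bl br tl tr) (h : ∀ p, L (K.cmGen p) = K.ratio p • L' (K.alexGen p))
    (k : CrossingKind) :
    (∀ x ∈ K.cmCrossing k bl br tl tr, L x = 0) ↔
      ∀ x ∈ K.alexCrossing' (K.turn k.switch bl br tl tr), L' x = 0 := by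
  obtain ⟨w, w', x, x', y, y', hw, hx, hy, hX, hY, r₁, r₂, r₃, r₄⟩ := ratio_corners ht hC
  -- Module identities become identities in a commutative ring, within reach of `grind`.
  obtain ⟨S, _, i, j, hj, hij⟩ := exists_commRing_embedding (Kappa n) M
  obtain ⟨b₁, b₂⟩ := hX bl (Or.inl rfl)
  obtain ⟨b₃, b₄⟩ := hX tr (Or.inr rfl)
  obtain ⟨a₁, a₂⟩ := hY br (Or.inl rfl)
  obtain ⟨a₃, a₄⟩ := hY tl (Or.inr rfl)
  have hw := congrArg i hw
  have hx := congrArg i hx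
  have hy := congrArg i hy
  rw [map_mul, map_one] at hw hx hy
  clear hX hY ht hC
  have hs : ∀ p, K.sgn p = if K.up p then 1 else -1 := fun p => rfl
  have hz : ∀ z : M, z = 0 ↔ j z = 0 := fun z => (map_eq_zero_iff j hj).symm
  -- Twelve cases: three kinds of crossing, four orientations.
  cases k <;> cases hbl : K.up bl <;> cases hbr : K.up br <;>
    simp only [hbl, hbr, if_true, if_false, Bool.false_eq_true] at r₁ r₂ r₃ r₄ <;>
    simp only [cmCrossing, alexCrossing', turn, CrossingKind.switch, foxRelator, hbl, hbr, hs,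
      if_true, if_false, Bool.false_eq_true, Set.mem_insert_iff, Set.mem_singleton_iff,
      forall_eq_or_imp, forall_eq, map_sub, map_add, map_neg, map_smul, h, r₁, r₂, r₃, r₄,
      b₁, b₂, b₃, b₄, a₁, a₂, a₃, a₄, neg_neg, hz, hij, map_mul, map_one] <;>
    generalize i w = w at * <;> generalize i w' = w' at * <;>
    generalize i x = x at * <;> generalize i x' = x' at * <;>
    generalize i y = y at * <;> generalize i y' = y' at * <;>
    generalize j (L' (K.alexGen bl)) = a at * <;> generalize j (L' (K.alexGen br)) = b at * <;>
    generalize j (L' (K.alexGen tl)) = c at * <;> generalize j (L' (K.alexGen tr)) = d at * <;>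
    clear * - hw hx hy <;> refine ⟨?_, ?_⟩ <;> rintro ⟨h₁, h₂⟩ <;> refine ⟨?_, ?_⟩ <;> grind

theorem nonempty_cm_equiv_alex' (K : VirtualLinkDiagram n) :
    Nonempty (K.CM ≃ₗ[Kappa n] K.mirror.Alex') := by
  -- `K` and its mirror image have the same curve, hence definitionally the same arcs.
  let B : Set (K.Arc →₀ Kappa n) := K.mirror.alexRelators'
  let L₁ : (K.MorseArc →₀ Kappa n) →ₗ[Kappa n] (K.Arc →₀ Kappa n) ⧸ Submodule.span (Kappa n) B :=
    Finsupp.semilift (RingHom.id _) (Quot.lift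
      (fun p => K.ratio p • Submodule.Quotient.mk (K.alexGen p)) (by
        rintro p q ⟨t, h⟩
        have : K.alexGen p = K.alexGen q :=
          congrArg (Finsupp.single · 1) (Quot.sound ⟨t, Or.inl h⟩)
        rw [ratio, ratio, index_passes h, sgn_passes h, this]))
  let L₂ : (K.Arc →₀ Kappa n) →ₗ[Kappa n] K.CM :=
    Finsupp.semilift (RingHom.id _) (Quot.lift
      (fun p => K.ratioInv p • Submodule.Quotient.mk (K.cmGen p)) (by
        rintro p q ⟨t, h | h⟩
        · have : K.cmGen p = K.cmGen q :=
            congrArg (Finsupp.single · 1) (Quot.sound ⟨t, h⟩)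
          rw [ratioInv, ratioInv, index_passes h, sgn_passes h, this]
        · have : (Submodule.Quotient.mk (K.cmGen p) : K.CM) + Submodule.Quotient.mk (K.cmGen q)
              = 0 := (Submodule.Quotient.mk_eq_zero _).2
            (Submodule.subset_span (Or.inl ⟨t, p, q, h, rfl⟩))
          rw [ratioInv, ratioInv, index_extremum h, sgn_extremum h, eq_neg_of_add_eq_zero_left this]
          simp))
  have e₁ : ∀ p, L₁ (K.cmGen p) = K.ratio p • Submodule.Quotient.mk (K.alexGen p) :=
    fun p => Finsupp.semilift_single _ _ _
  have e₂ : ∀ p, L₂ (K.alexGen p) = K.ratioInv p • Submodule.Quotient.mk (K.cmGen p) :=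
    fun p => Finsupp.semilift_single _ _ _
  have k₁ : ∀ x ∈ K.cmRelators, L₁ x = 0 := by
    rintro x (⟨t, p, q, h, rfl⟩ | ⟨t, bl, br, tl, tr, hC, hx⟩)
    · have : K.alexGen p = K.alexGen q :=
        congrArg (Finsupp.single · 1) (Quot.sound (joinedSmooth_of_extremum h))
      rw [map_add, e₁, e₁, ratio, ratio, index_extremum h, sgn_extremum h, this]
      simp
    · refine (forall_crossing_iff L₁ (Submodule.mkQ _) t.2 hC e₁ (K.kind t)).2 ?_ x hx
      exact fun y hy => (Submodule.Quotient.mk_eq_zero _).2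
        (Submodule.subset_span ⟨t, bl, br, tl, tr, hC, hy⟩)
  have k₂ : ∀ x ∈ B, L₂ x = 0 := by
    rintro x ⟨t, bl, br, tl, tr, hC, hx⟩
    refine (forall_crossing_iff (Submodule.mkQ _) L₂ t.2 hC (fun p => ?_) (K.kind t)).1 ?_ x hx
    · rw [e₂, smul_smul, ratio_mul_ratioInv, one_smul]
      rfl
    · exact fun y hy => (Submodule.Quotient.mk_eq_zero _).2
        (Submodule.subset_span (Or.inr ⟨t, bl, br, tl, tr, hC, hy⟩))
  refine exists_presentation_equiv (r₁ := K.JoinedPlain) (r₂ := K.JoinedSmooth)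
    (A₁ := K.cmRelators) (A₂ := B) (RingHom.id _) (RingHom.id _) L₁ L₂ k₁ k₂ ?_ ?_
  · intro F hF p
    refine (congrArg F (e₁ p)).trans ?_
    rw [map_smul, hF, e₂, smul_smul, ratio_mul_ratioInv, one_smul]
    rfl
  · intro F hF p
    refine (congrArg F (e₂ p)).trans ?_
    rw [map_smul, hF, e₁, smul_smul, mul_comm, ratio_mul_ratioInv, one_smul]
    rfl

theorem alexRelators_eq_of_isClassical (h : K.IsClassical) :
    K.alexRelators = K.alexRelators' := by
  have key : ∀ t bl br tl tr, K.alexCrossing (K.turn (K.kind t) bl br tl tr) =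
      K.alexCrossing' (K.turn (K.kind t) bl br tl tr) := by
    intro t bl br tl tr
    have ht := h t
    cases hk : K.kind t <;> cases hbl : K.up bl <;> cases hbr : K.up br <;>
      simp_all [turn, alexCrossing, alexCrossing', CrossingKind.switch]
  simp only [alexRelators, alexRelators', key]

theorem IsClassical.mirror (h : K.IsClassical) : K.mirror.IsClassical := by
  intro t ht
  have ht : (K.kind t).switch = .virtual := ht
  have := h t
  cases hk : K.kind t <;> simp_all [CrossingKind.switch]

theorem IsClassical.nonempty_cm_equiv_alex (h : K.IsClassical) :
    Nonempty (K.CM ≃ₗ[Kappa n] K.mirror.Alex) := by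
  obtain ⟨e⟩ := nonempty_cm_equiv_alex' K
  exact ⟨e.trans (Submodule.quotEquivOfEq _ _
    (congrArg _ (alexRelators_eq_of_isClassical h.mirror).symm))⟩

/-! ### Comparison of `CM(K)` and `CM(K*)` -/

/-- For each kind of crossing, adding the two relations gives `c + d = e + f`. -/
theorem isFlow_of_cmRelators {M : Type} [AddCommGroup M] [Module (Kappa n) M]
    (L : (K.MorseArc →₀ Kappa n) →ₗ[Kappa n] M) (h : ∀ x ∈ K.cmRelators, L x = 0) :
    K.IsFlow fun p => L (K.cmGen p) where
  passes t p q hp := congrArg (fun a => L (Finsupp.single a 1)) (Quot.sound ⟨t, hp⟩)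
  extremum t p q hp := by rw [← map_add]; exact h _ (Or.inl ⟨t, p, q, hp, rfl⟩)
  crossing t bl br tl tr ht hC := by
    have := fun x hx => h x (Or.inr ⟨⟨t, ht⟩, bl, br, tl, tr, hC, hx⟩)
    cases hk : K.kind ⟨t, ht⟩ <;>
      simp only [hk, cmCrossing, Set.mem_insert_iff, Set.mem_singleton_iff, forall_eq_or_imp,
        forall_eq, map_sub, map_add, sub_eq_zero] at this <;>
      rw [this.1, this.2] <;> abel

variable (K) in
/-- The increments of the region function obtained from the partial sums of `g` by dividing by
the Alexander numbering. -/
def twist {M : Type} [AddCommGroup M] [Module (Kappa n) M] (g : K.Point → M) (p : K.Point) : M :=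
  Kappa.T (-K.right K.charge p) • K.right g p - Kappa.T (-K.left K.charge p) • K.left g p

/-- With `G`, `G'` the partial sums of `g`, `g'`, telescoping gives `Φ G = T(-A) G'`. Hence `Φ
(T(-A) G) = T(A) T(-A) G' = G'`, and one takes increments. -/
theorem map_twist {M M' : Type} [AddCommGroup M] [Module (Kappa n) M] [AddCommGroup M']
    [Module (Kappa n) M'] (Φ : M →ₛₗ[Kappa.bar n] M') {g : K.Point → M} {g' : K.Point → M'}
    (h : ∀ p, Φ (g p) = K.twist g' p) (p : K.Point) : Φ (K.twist g p) = g' p := by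
  have key : ∀ t j, j ≤ K.width t → Φ (Kappa.T (-K.partialSum K.charge t j) • K.partialSum g t j)
      = K.partialSum g' t j := by
    intro t j hj
    have h₁ : Φ (K.partialSum g t j) = K.partialSum (fun p => Φ (g p)) t j :=
      map_partialSum Φ.toAddMonoidHom g t j
    have h₂ := partialSum_sub (C := K.toMorseCurve)
      (fun t j => Kappa.T (-K.partialSum K.charge t j) • K.partialSum g' t j) t hj
    -- The unbounded region on the left has value `0`, so telescoping leaves no constant.
    have h₃ : K.partialSum g' t 0 = 0 := sum_range_zero _
    rw [h₃, smul_zero, sub_zero] at h₂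
    rw [LinearMap.map_smulₛₗ, h₁, funext h, Kappa.bar_T, neg_neg]
    refine (congrArg _ h₂).trans ?_
    rw [smul_smul, Kappa.T_mul_T_neg, one_smul]
  rw [twist, map_sub]
  refine (congrArg₂ _ (key p.1 (p.2 + 1) p.2.2) (key p.1 p.2 p.2.2.le)).trans ?_
  rw [partialSum_succ, value_eq g' p rfl rfl, add_sub_cancel_left]

/-- Let `l, b, r, u` be the values of the region function of `L'` on the left, bottom, right and top
regions, and `x`, `y` the charge monomials of the rising and falling strands. A falling over strand
means `r - u = y (b - l)`. After division by `T(A)` this is the bar-conjugate of `u - l = x⁻¹ (r -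
b)`, the relation for a rising over strand; the other case is symmetric. The remaining relation is
the flow condition. -/
theorem forall_crossing_twist {M : Type} [AddCommGroup M] [Module (Kappa n) M]
    (L : (K.MorseArc →₀ Kappa n) →ₛₗ[Kappa.bar n] M) (L' : (K.MorseArc →₀ Kappa n) →ₗ[Kappa n] M)
    (hF : K.IsFlow fun p => L' (K.cmGen p))
    {t : Fin K.height} {bl br tl tr : K.Point} (ht : K.shape t = .doublePoint)
    (hC : K.Corners t bl br tl tr) (h : ∀ p, L (K.cmGen p) = K.twist (fun p => L' (K.cmGen p)) p)
    {k : CrossingKind} (hk : k ≠ .virtual)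
    (h' : ∀ x ∈ K.cmCrossing k.switch bl br tl tr, L' x = 0) :
    ∀ x ∈ K.cmCrossing k bl br tl tr, L x = 0 := by
  obtain ⟨c₁, c₂⟩ := charge_corners ht hC
  obtain ⟨l₁, l₂⟩ := left_of_corners K.charge hC
  have l₃ := isFlow_charge.left_corners hC
  obtain ⟨m₁, m₂⟩ := left_of_corners (fun p => L' (K.cmGen p)) hC
  have m₃ := hF.left_corners hC
  obtain ⟨S, _, i, j, hj, hij⟩ := exists_commRing_embedding (Kappa n) M
  have hz : ∀ z : M, z = 0 ↔ j z = 0 := fun z => (map_eq_zero_iff j hj).symm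
  have hX : ∀ p, K.X p (K.sgn p) = Kappa.T (K.charge p) := fun p => rfl
  have hX' : ∀ p, K.X p (-K.sgn p) = Kappa.T (-K.charge p) := fun p => by
    rw [charge, ← Finsupp.single_neg]; rfl
  have hx := congrArg i (Kappa.T_mul_T_neg (K.charge bl))
  have hy := congrArg i (Kappa.T_mul_T_neg (K.charge br))
  rw [map_mul, map_one] at hx hy
  cases k <;> simp only [ne_eq, not_true_eq_false] at hk <;>
    simp only [cmCrossing, CrossingKind.switch, twist, right_eq, l₁, l₂, l₃, m₁, m₂, m₃, c₁, c₂,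
      hX, hX', Set.mem_insert_iff, Set.mem_singleton_iff, forall_eq_or_imp, forall_eq, map_sub,
      map_add, LinearMap.map_smulₛₗ, RingHom.id_apply, h, neg_add, Kappa.T_add, Kappa.bar_T,
      neg_neg, hz, hij, map_mul] at h' ⊢ <;>
    generalize i (Kappa.T (K.charge bl)) = x at * <;>
    generalize i (Kappa.T (-K.charge bl)) = x' at * <;>
    generalize i (Kappa.T (K.charge br)) = y at * <;>
    generalize i (Kappa.T (-K.charge br)) = y' at * <;>
    generalize i (Kappa.T (-K.left K.charge bl)) = w at * <;>
    generalize j (K.left (fun p => L' (K.cmGen p)) bl) = v at * <;>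
    generalize j (L' (K.cmGen bl)) = a at * <;> generalize j (L' (K.cmGen br)) = b at * <;>
    generalize j (L' (K.cmGen tl)) = c at * <;> generalize j (L' (K.cmGen tr)) = d at * <;>
    clear * - hx hy h' <;> obtain ⟨h₁, h₂⟩ := h' <;> refine ⟨?_, ?_⟩ <;> grind

theorem twist_passes {M : Type} [AddCommGroup M] [Module (Kappa n) M] {g : K.Point → M}
    (hg : K.IsFlow g) {t : Fin K.height} {p q : K.Point} (h : K.Passes t p q) :
    K.twist g p = K.twist g q := by
  rw [twist, twist, isFlow_charge.left_passes h, isFlow_charge.right_passes h, hg.left_passes h,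
    hg.right_passes h]

theorem twist_extremum {M : Type} [AddCommGroup M] [Module (Kappa n) M] {g : K.Point → M}
    (hg : K.IsFlow g) {t : Fin K.height} {p q : K.Point} (h : K.IsMin t p q ∨ K.IsMax t p q) :
    K.twist g p + K.twist g q = 0 := by
  rw [twist, twist, isFlow_charge.right_of_extremum h, hg.right_of_extremum h,
    left_of_extremum _ h, left_of_extremum _ h]
  abel

theorem IsClassical.exists_twist_map (hK : K.IsClassical) {M : Type} [AddCommGroup M]
    [Module (Kappa n) M] (L' : (K.MorseArc →₀ Kappa n) →ₗ[Kappa n] M)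
    (h' : ∀ x ∈ K.mirror.cmRelators, L' x = 0) :
    ∃ L : (K.MorseArc →₀ Kappa n) →ₛₗ[Kappa.bar n] M, (∀ x ∈ K.cmRelators, L x = 0) ∧
      ∀ p, L (K.cmGen p) = K.twist (fun p => L' (K.cmGen p)) p := by
  have hF : K.IsFlow fun p => L' (K.cmGen p) := isFlow_of_cmRelators (K := K.mirror) L' h'
  let L : (K.MorseArc →₀ Kappa n) →ₛₗ[Kappa.bar n] M :=
    Finsupp.semilift (Kappa.bar n) (Quot.lift (K.twist fun p => L' (K.cmGen p))
      fun p q ⟨_, h⟩ => twist_passes hF h)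
  have e : ∀ p, L (K.cmGen p) = K.twist (fun p => L' (K.cmGen p)) p :=
    fun p => Finsupp.semilift_single _ _ _
  refine ⟨L, ?_, e⟩
  rintro x (⟨t, p, q, h, rfl⟩ | ⟨t, bl, br, tl, tr, hC, hx⟩)
  · rw [map_add, e, e, twist_extremum hF h]
  · exact forall_crossing_twist L L' hF t.2 hC e (hK t)
      (fun y hy => h' y (Or.inr ⟨t, bl, br, tl, tr, hC, hy⟩)) x hx

theorem IsClassical.nonempty_cm_equiv_cm_mirror (hK : K.IsClassical) :
    Nonempty (K.CM ≃ₛₗ[Kappa.bar n] K.mirror.CM) := by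
  let g : K.Point → K.CM := fun p => Submodule.Quotient.mk (K.cmGen p)
  let g' : K.Point → K.mirror.CM := fun p => Submodule.Quotient.mk (K.mirror.cmGen p)
  obtain ⟨L₁, k₁, e₁⟩ := hK.exists_twist_map (Submodule.span (Kappa n) K.mirror.cmRelators).mkQ
    fun x hx => (Submodule.Quotient.mk_eq_zero _).2 (Submodule.subset_span hx)
  obtain ⟨L₂, k₂, e₂⟩ := hK.mirror.exists_twist_map (Submodule.span (Kappa n) K.cmRelators).mkQ <| by
    refine fun x hx => (Submodule.Quotient.mk_eq_zero _).2 (Submodule.subset_span ?_)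
    obtain h | ⟨t, bl, br, tl, tr, hC, hx⟩ := hx
    · exact Or.inl h
    -- Relators of the double mirror image are relators of `K`.
    · have hx : x ∈ K.cmCrossing (K.kind t).switch.switch bl br tl tr := hx
      rw [CrossingKind.switch_switch] at hx
      exact Or.inr ⟨t, bl, br, tl, tr, hC, hx⟩
  refine exists_presentation_equiv (Kappa.bar n) (Kappa.bar n) L₁ L₂ k₁ k₂ ?_ ?_
  · intro F hF p
    exact (congrArg F (e₁ p)).trans
      (map_twist (K := K) F (g := g') (g' := g) (fun q => (hF _).trans (e₂ q)) p)
  · intro F hF p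
    exact (congrArg F (e₂ p)).trans
      (map_twist (K := K.mirror) F (g := g) (g' := g') (fun q => (hF _).trans (e₁ q)) p)

end VirtualLinkDiagram

end

theorem mainTheorem3 (n : ℕ) (K : VirtualLinkDiagram n) :
    Nonempty (K.CM ≃ₗ[Kappa n] K.mirror.Alex') ∧
    (K.IsClassical →
      Nonempty (K.CM ≃ₗ[Kappa n] K.mirror.Alex) ∧
      ∃ φ : K.CM ≃+ K.Alex, ∀ (r : Kappa n) (x : K.CM), φ (r • x) = Kappa.bar n r • φ x) := by
  refine ⟨K.nonempty_cm_equiv_alex', fun h => ⟨h.nonempty_cm_equiv_alex, ?_⟩⟩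
  obtain ⟨Φ⟩ := h.nonempty_cm_equiv_cm_mirror
  -- The linear comparison for the mirror image ends in the Alexander module of its own mirror
  -- image, which is `K`.
  have hΨ := h.mirror.nonempty_cm_equiv_alex
  rw [VirtualLinkDiagram.mirror_mirror] at hΨ
  obtain ⟨Ψ⟩ := hΨ
  refine ⟨Φ.toAddEquiv.trans Ψ.toAddEquiv, fun r x => ?_⟩
  change Ψ (Φ (r • x)) = Kappa.bar n r • Ψ (Φ x)
  rw [LinearEquiv.map_smulₛₗ, map_smul]
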